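/- Let $\mathcal W$ be the Wiener algebra of series $a(z)=\sum_{i\in\mathbb Z}a_iz^i$ with $\sum_i|a_i|<\infty$, let $T(a)=(a_{j-i})_{i,j\ge1}$ be the semi-infinite Toeplitz matrix with symbol $a$, let $\mathcal K_d$ be the set of matrices $E=(e_{i,j})_{i,j\ge1}$ with finite absolute row sums and $\lim_{i}\sum_j|e_{i,j}|=0$, and let $\mathcal{QT}_\infty=\{T(a)+E:\ a\in\mathcal W,\ E\in\mathcal K_d\}$, regarded as bounded operators on $\ell^\infty$ with the norm $\|A\|_\infty=\sup_i\sum_j|a_{i,j}|$. Write $\rho$ for the spectral radius. A matrix $A\in\mathcal{QT}_\infty$ is a (quasi-Toeplitz) $M$-matrix if $A=\beta I-C$ with $\beta\ge0$, $C\ge0$ entrywise and $\rho(C)\le\beta$. **Theorem.** Let $A=I-A_1\in\mathcal{QT}_\infty$ with $A_1\ge0$ entrywise and $\|A_1\|_\infty<1$, and let $B=T(b)+E_B$ with $b\in\mathcal W$, $E_B\in\mathcal K_d$ be such that $I-B$ is the quasi-Toeplitz $M$-matrix with $(I-B)^2=A$. Then $2I-T(b)$, $2I-B$ and, with $V=(2I-B)^{-1}$,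 also $I-T(b)V$ are invertible, and we put $$S=(2I-T(b))^{-1},\qquad R=T(b)^2-2T(b)+A_1,\qquad Z=(I-T(b)V)\,V\,(I-T(b)V)^{-1}.$$ Apply the structure-preserving doubling algorithm (SDA) to the pencil $\mathcal M-\lambda\mathcal N$, $$\mathcal M=\begin{bmatrix}SA_1&0\\-SR&I\end{bmatrix},\qquad \mathcal N=\begin{bmatrix}I&-S\\0&S\end{bmatrix},$$ that is, put $E_0=SA_1$, $P_0=SR$, $F_0=Q_0=S$ and $$\begin{aligned}E_{k+1}&=E_k(I-Q_kP_k)^{-1}E_k,& P_{k+1}&=P_k+F_k(I-P_kQ_k)^{-1}P_kE_k,\\ F_{k+1}&=F_k(I-P_kQ_k)^{-1}F_k,& Q_{k+1}&=Q_k+E_k(I-Q_kP_k)^{-1}Q_kF_k.\end{aligned}$$ Suppose that there is no breakdown, that is, $I-Q_kP_k$ and $I-P_kQ_k$ are invertible for all $k\ge0$. Then $P_k\to E_B$ in norm, and the convergence is quadratic in the sense that $$\limsup_{k\to\infty}\|E_B-P_k\|_\infty^{1/2^k}\le\rho(B)\,\rho(Z)<1 .$$ -/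

import Mathlib

open Filter Topology
open scoped ENNReal

/-- The complex Banach space `ℓ^∞` of bounded sequences, indexed by `ℕ` (rows and columns of
semi-infinite matrices are numbered from `0`). -/
abbrev LInf : Type := lp (fun _ : ℕ => ℂ) ∞

/-- `𝓑(ℓ^∞)`, the Banach algebra of bounded operators on `ℓ^∞` with the operator norm. For an
operator given by a matrix this norm is the infinity norm `sup_i ∑_j |m i j|`. -/
abbrev LInfOp : Type := LInf →L[ℂ] LInf

/-- The absolute row sums of the semi-infinite matrix `m` are finite and uniformly bounded, that
is, `‖m‖_∞ < ∞`. -/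
def BoundedRows (m : ℕ → ℕ → ℂ) : Prop :=
  ∃ C : ℝ, ∀ i, Summable (fun j => ‖m i j‖) ∧ ∑' j, ‖m i j‖ ≤ C

theorem BoundedRows.row_bound {m : ℕ → ℕ → ℂ} {C : ℝ}
    (hC : ∀ i, Summable (fun j => ‖m i j‖) ∧ ∑' j, ‖m i j‖ ≤ C) (x : LInf) (i : ℕ) :
    Summable (fun j => ‖m i j * x j‖) ∧ ‖∑' j, m i j * x j‖ ≤ C * ‖x‖ := by
  have hle : ∀ j, ‖m i j * x j‖ ≤ ‖m i j‖ * ‖x‖ := fun j => by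
    rw [norm_mul]
    exact mul_le_mul_of_nonneg_left (lp.norm_apply_le_norm ENNReal.top_ne_zero x j)
      (norm_nonneg _)
  have hs' : Summable (fun j => ‖m i j‖ * ‖x‖) := (hC i).1.mul_right _
  have hs : Summable (fun j => ‖m i j * x j‖) :=
    Summable.of_nonneg_of_le (fun _ => norm_nonneg _) hle hs'
  refine ⟨hs, (norm_tsum_le_tsum_norm hs).trans ((hs.tsum_le_tsum hle hs').trans ?_)⟩
  rw [tsum_mul_right]
  exact mul_le_mul_of_nonneg_right (hC i).2 (norm_nonneg _)

theorem BoundedRows.memℓp {m : ℕ → ℕ → ℂ} (hm : BoundedRows m) (x : LInf) :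
    Memℓp (fun i => ∑' j, m i j * x j) ∞ := by
  obtain ⟨C, hC⟩ := hm
  refine memℓp_infty ⟨C * ‖x‖, ?_⟩
  rintro _ ⟨i, rfl⟩
  exact (BoundedRows.row_bound hC x i).2

/-- The bounded operator `x ↦ (∑_j m i j * x j)_i` on `ℓ^∞` of a matrix with bounded rows. -/
noncomputable def matrixOp (m : ℕ → ℕ → ℂ) (hm : BoundedRows m) : LInfOp :=
  LinearMap.mkContinuousOfExistsBound
    { toFun := fun x => ⟨fun i => ∑' j, m i j * x j, hm.memℓp x⟩
      map_add' := by
        intro x y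
        obtain ⟨C, hC⟩ := hm
        ext i
        have hx := (BoundedRows.row_bound hC x i).1.of_norm
        have hy := (BoundedRows.row_bound hC y i).1.of_norm
        change ∑' j, m i j * (x j + y j) = ∑' j, m i j * x j + ∑' j, m i j * y j
        rw [← hx.tsum_add hy]
        simp only [mul_add]
      map_smul' := by
        intro c x
        ext i
        change ∑' j, m i j * (c * x j) = c * ∑' j, m i j * x j
        rw [← tsum_mul_left]
        simp only [mul_left_comm] }
    (by
      obtain ⟨C, hC⟩ := hm
      refine ⟨C, fun x => ?_⟩
      have h0 : 0 ≤ C := (tsum_nonneg fun j => norm_nonneg (m 0 j)).trans (hC 0).2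
      exact lp.norm_le_of_forall_le (mul_nonneg h0 (norm_nonneg x))
        fun i => (BoundedRows.row_bound hC x i).2)

/-- The Wiener algebra `𝓦`: absolutely summable two-sided coefficient sequences, `a` standing for
the function `∑_{i ∈ ℤ} a i * z ^ i` on the unit circle. -/
abbrev Wiener : Type := {a : ℤ → ℂ // Summable fun n => ‖a n‖}

theorem Wiener.boundedRows (a : Wiener) :
    BoundedRows (fun i j => a.1 ((j : ℤ) - (i : ℤ))) := by
  refine ⟨∑' n, ‖a.1 n‖, fun i => ?_⟩
  have hinj : Function.Injective (fun j : ℕ => (j : ℤ) - (i : ℤ)) := fun j k h => by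
    have h' : (j : ℤ) - (i : ℤ) = (k : ℤ) - (i : ℤ) := h
    omega
  exact ⟨a.2.comp_injective hinj, tsum_comp_le_tsum_of_inj a.2 (fun _ => norm_nonneg _) hinj⟩

/-- The semi-infinite Toeplitz matrix `T(a)`, with entries `(T(a))_{i,j} = a_{j-i}`. -/
noncomputable def toeplitz (a : Wiener) : LInfOp :=
  matrixOp (fun i j => a.1 ((j : ℤ) - (i : ℤ))) a.boundedRows

/-- `𝓚_d(ℓ^∞)`: (operators of) matrices `e` whose absolute row sums are finite and tend to `0`. -/
def Kd : Set LInfOp :=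
  {E | ∃ (e : ℕ → ℕ → ℂ) (he : BoundedRows e),
    Tendsto (fun i => ∑' j, ‖e i j‖) atTop (𝓝 0) ∧ E = matrixOp e he}

/-- The class `𝓠𝓣_∞` of quasi-Toeplitz matrices `T(a) + E`, `a ∈ 𝓦`, `E ∈ 𝓚_d(ℓ^∞)`. -/
def QT : Set LInfOp :=
  {A | ∃ (a : Wiener) (E : LInfOp), E ∈ Kd ∧ A = toeplitz a + E}

/-- The entry in position `(i, j)` of the matrix of an operator. -/
noncomputable def entry (A : LInfOp) (i j : ℕ) : ℂ :=
  (A (lp.single ∞ j (1 : ℂ)) : LInf) i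

/-- Elementwise nonnegativity `A ≥ 0`: every entry is a nonnegative real number. -/
def EntrywiseNonneg (A : LInfOp) : Prop :=
  ∀ i j, 0 ≤ (entry A i j).re ∧ (entry A i j).im = 0

/-- Quasi-Toeplitz `M`-matrices: `A ∈ 𝓠𝓣_∞` with `A = β I - C`, `C ≥ 0` and `β ≥ ρ(C)`. -/
def IsQTMMatrix (A : LInfOp) : Prop :=
  A ∈ QT ∧ ∃ (β : ℝ) (C : LInfOp), 0 ≤ β ∧ EntrywiseNonneg C ∧
    spectralRadius ℂ C ≤ ENNReal.ofReal β ∧ A = (β : ℂ) • (1 : LInfOp) - C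

/-- Coefficients of a pencil `M - λ N` in standard structured form I,
`M = [E, 0; -P, I]`, `N = [I, -Q; 0, F]`. -/
@[ext]
structure SSF (R : Type*) where
  E : R
  P : R
  F : R
  Q : R

/-- The matrix `M = [E, 0; -P, I]` of the pencil. -/
def SSF.M {R : Type*} [Ring R] (s : SSF R) : Matrix (Fin 2) (Fin 2) R :=
  !![s.E, 0; -s.P, 1]

/-- The matrix `N = [I, -Q; 0, F]` of the pencil. -/
def SSF.N {R : Type*} [Ring R] (s : SSF R) : Matrix (Fin 2) (Fin 2) R :=
  !![1, -s.Q; 0, s.F]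

/-- One doubling step. `Ring.inverse` is the two-sided inverse wherever there is one. -/
noncomputable def SSF.step {R : Type*} [Ring R] (s : SSF R) : SSF R where
  E := s.E * Ring.inverse (1 - s.Q * s.P) * s.E
  P := s.P + s.F * Ring.inverse (1 - s.P * s.Q) * s.P * s.E
  F := s.F * Ring.inverse (1 - s.P * s.Q) * s.F
  Q := s.Q + s.E * Ring.inverse (1 - s.Q * s.P) * s.Q * s.F

/-- The `k`-th iterate `(E_k, P_k, F_k, Q_k)` of the structure-preserving doubling algorithm. -/
noncomputable def SSF.sda {R : Type*} [Ring R] (s : SSF R) : ℕ → SSF R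
  | 0 => s
  | k + 1 => (s.sda k).step

/-- The doubling algorithm runs with no breakdown: every inverse that it uses exists. -/
def SSF.NoBreakdown {R : Type*} [Ring R] (s : SSF R) : Prop :=
  ∀ k, IsUnit (1 - (s.sda k).Q * (s.sda k).P) ∧ IsUnit (1 - (s.sda k).P * (s.sda k).Q)

/-! Write `T = T(b)` and `X = E_B`. The pencil has two complementary invariance relations: one for
`[1; X]` with restriction `B`, one for `[Y; 1]` with `Y = V(1 - TV)⁻¹` and restriction `Z` (on the
`N` side). A doubling step keeps `X` and `Y` and squares `B` and `Z`. So `X - P_k = F_k X B^(2^k)`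
and `F_k = (1 - P_k Y) Z^(2^k)`. Eliminating `F_k` gives `SSF.error_eq`, whose last term can be
absorbed once `Z^(2^k)` and `B^(2^k)` are small; Gelfand's formula then gives the rate.

Smallness comes from `‖B‖ < 1` (`norm_lt_one_of_sq`). A contraction yields a square root `1 - Y'` of
`1 - A₁` with `‖Y'‖ < 1` and `Y'` commuting with `B`; the M-matrix condition makes `(1 - B) + (1 -
Y')` invertible, and this factor annihilates `Y' - B`, so `B = Y'`. Far down, the rows of `E_B` are
negligible, hence `‖T‖ ≤ ‖B‖ < 1` (`norm_toeplitz_le_norm_add`). Finally `‖V‖ < 1`, so `1 - TV` is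
invertible and `Z`, being similar to `V`, has spectral radius below one. -/

/-! ### The doubling step -/

namespace SSF

variable {R : Type*} [Ring R]

/-- The pencil with the roles of `(E, P)` and `(F, Q)` exchanged. -/
def swap (s : SSF R) : SSF R := ⟨s.F, s.Q, s.E, s.P⟩

theorem swap_step (s : SSF R) : s.swap.step = s.step.swap := rfl

theorem swap_sda (s : SSF R) (k : ℕ) : s.swap.sda k = (s.sda k).swap := by
  induction k with
  | zero => rfl
  | succ k ih => simp only [sda, ih, swap_step]

/-- `M [1; X] = N [1; X] W`, written out in blocks. -/
def Solves (s : SSF R) (X W : R) : Prop :=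
  s.E = (1 - s.Q * X) * W ∧ X - s.P = s.F * X * W

/-- A doubling step keeps the deflating subspace spanned by `[1; X]` and squares the
restriction of the pencil to it. -/
theorem Solves.step {s : SSF R} {X W : R} (h : s.Solves X W)
    (hQP : IsUnit (1 - s.Q * s.P)) (hPQ : IsUnit (1 - s.P * s.Q)) :
    s.step.Solves X (W ^ 2) := by
  obtain ⟨E, P, F, Q⟩ := s
  obtain ⟨hE, hX⟩ := h
  simp only [SSF.step, Solves] at *
  have hG := Ring.inverse_mul_cancel _ hQP
  have hH := Ring.inverse_mul_cancel _ hPQ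
  have hHr := Ring.mul_inverse_cancel _ hPQ
  set G := Ring.inverse (1 - Q * P)
  set H := Ring.inverse (1 - P * Q)
  -- Splitting `X = P + F X W` inside `E = (1 - Q X) W` exposes the factor `1 - Q P` that `G`
  -- cancels.
  have hEsplit : E = (1 - Q * P) * W - Q * F * X * W * W := by
    have : Q * F * X * W = Q * (X - P) := by rw [hX]; noncomm_ring
    rw [this, hE]; noncomm_ring
  constructor
  · calc E * G * E = E * G * ((1 - Q * P) * W - Q * F * X * W * W) := by rw [← hEsplit]
      _ = E * (G * (1 - Q * P)) * W - E * G * Q * F * X * W * W := by noncomm_ring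
      _ = (1 - Q * X) * W * W - E * G * Q * F * X * W * W := by rw [hG, mul_one, ← hE]
      _ = _ := by noncomm_ring
  · have key : X * W - H * P * E = H * (X - P) * W := by
      calc X * W - H * P * E = (H * (1 - P * Q)) * X * W - H * P * ((1 - Q * X) * W) := by
            rw [hH, ← hE]; noncomm_ring
        _ = _ := by noncomm_ring
    calc X - (P + F * H * P * E) = (X - P) - F * H * P * E := by noncomm_ring
      _ = F * (X * W - H * P * E) := by rw [hX]; noncomm_ring
      _ = F * (H * (F * X * W) * W) := by rw [key, ← hX]
      _ = _ := by noncomm_ring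

theorem Solves.sda {s : SSF R} {X W : R} (h : s.Solves X W) (hs : s.NoBreakdown) (k : ℕ) :
    (s.sda k).Solves X (W ^ 2 ^ k) := by
  induction k with
  | zero => simpa [SSF.sda] using h
  | succ k ih =>
    have := ih.step (hs k).1 (hs k).2
    rwa [← pow_mul, ← pow_succ] at this

theorem NoBreakdown.swap {s : SSF R} (hs : s.NoBreakdown) : s.swap.NoBreakdown := fun k => by
  rw [swap_sda]
  exact (hs k).symm

/-- The error equation of the doubling algorithm. -/
theorem error_eq {s : SSF R} {X W Y Z : R} (h : s.Solves X W) (h' : s.swap.Solves Y Z)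
    (hs : s.NoBreakdown) (k : ℕ) :
    X - (s.sda k).P = (1 - X * Y) * Z ^ 2 ^ k * X * W ^ 2 ^ k
      + (X - (s.sda k).P) * (Y * Z ^ 2 ^ k * X * W ^ 2 ^ k) := by
  have h₁ := (h.sda hs k).2
  have h₂ := (h'.sda hs.swap k).1
  rw [swap_sda] at h₂
  change (s.sda k).F = (1 - (s.sda k).P * Y) * Z ^ 2 ^ k at h₂
  conv_lhs => rw [h₁, h₂]
  noncomm_ring

end SSF

/-! ### Algebraic identities for the square root -/

section Pencil

variable {R : Type*} [Ring R] {A₁ B T X S V : R}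

/-- The square root equation reads `A₁ = (2 - B) B`. After multiplication by `2 - T`, the two
relations reduce to this and to `2B - TB - A₁ = (B - T) B`. -/
theorem solves_of_sq (hB : B = T + X) (hsq : (1 - B) ^ 2 = 1 - A₁) (hS : S * (2 - T) = 1) :
    (SSF.mk (S * A₁) (S * (T ^ 2 - 2 * T + A₁)) S S).Solves X B := by
  have hA₁ : A₁ = (2 - B) * B := by
    have : A₁ = 1 - (1 - B) ^ 2 := by rw [hsq]; noncomm_ring
    rw [this]; noncomm_ring
  constructor
  · change S * A₁ = (1 - S * X) * B
    rw [← hS, hA₁, hB]; noncomm_ring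
  · change X - S * (T ^ 2 - 2 * T + A₁) = S * X * B
    calc X - S * (T ^ 2 - 2 * T + A₁) = (S * (2 - T)) * X - S * (T ^ 2 - 2 * T + A₁) := by
          rw [hS, one_mul]
      _ = S * X * B := by rw [hA₁, hB]; noncomm_ring

/-- The quadratic `x² - 2x + A₁` has the second root `2 - B = V⁻¹`, that is, `A₁ V² = 2V - 1`. It
yields the subspace spanned by `[V; 1 - T V]` with restriction `V`; right multiplication by `J`
normalises the lower block to `1` and conjugates `V`. -/
theorem swap_solves_of_sq {J : R} (hsq : (1 - B) ^ 2 = 1 - A₁) (hS : S * (2 - T) = 1)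
    (hV : (2 - B) * V = 1) (hJ : (1 - T * V) * J = 1) (hJ' : J * (1 - T * V) = 1) :
    (SSF.mk (S * A₁) (S * (T ^ 2 - 2 * T + A₁)) S S).swap.Solves (V * J)
      ((1 - T * V) * V * J) := by
  have hBV : B * V = 2 * V - 1 := by rw [← hV]; noncomm_ring
  have hA₁V : A₁ * V * V = 2 * V - 1 := by
    have h : A₁ = B * (2 - B) := by
      have : A₁ = 1 - (1 - B) ^ 2 := by rw [hsq]; noncomm_ring
      rw [this]; noncomm_ring
    rw [h, mul_assoc B, hV, mul_one, hBV]
  have hYZ : V * J * ((1 - T * V) * V * J) = V * V * J := by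
    calc V * J * ((1 - T * V) * V * J) = V * (J * (1 - T * V)) * V * J := by noncomm_ring
      _ = _ := by rw [hJ', mul_one]
  have hY : A₁ * (V * V * J) = (2 - T) * (V * J) - 1 := by
    calc A₁ * (V * V * J) = A₁ * V * V * J := by noncomm_ring
      _ = (2 - T) * (V * J) - (1 - T * V) * J := by rw [hA₁V]; noncomm_ring
      _ = _ := by rw [hJ]
  constructor
  · change S = (1 - S * (T ^ 2 - 2 * T + A₁) * (V * J)) * ((1 - T * V) * V * J)
    symm
    calc (1 - S * (T ^ 2 - 2 * T + A₁) * (V * J)) * ((1 - T * V) * V * J)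
        = (1 - T * V) * V * J
          - S * (T ^ 2 - 2 * T + A₁) * (V * J * ((1 - T * V) * V * J)) := by noncomm_ring
      _ = (1 - T * V) * V * J - S * (T ^ 2 - 2 * T + A₁) * (V * V * J) := by rw [hYZ]
      _ = (1 - T * V) * V * J + (S * (2 - T)) * (T * V * V * J) - S * (A₁ * (V * V * J)) := by
          noncomm_ring
      _ = V * J - S * ((2 - T) * (V * J) - 1) := by rw [hS, hY]; noncomm_ring
      _ = V * J - (S * (2 - T)) * (V * J) + S := by noncomm_ring
      _ = S := by rw [hS]; noncomm_ring
  · change V * J - S = S * A₁ * (V * J) * ((1 - T * V) * V * J)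
    symm
    calc S * A₁ * (V * J) * ((1 - T * V) * V * J)
        = S * (A₁ * (V * J * ((1 - T * V) * V * J))) := by noncomm_ring
      _ = (S * (2 - T)) * (V * J) - S := by rw [hYZ, hY]; noncomm_ring
      _ = _ := by rw [hS, one_mul]

end Pencil

/-! ### Square roots in Banach algebras -/

section BanachAlgebra

variable {R : Type*} [NormedRing R] [NormedAlgebra ℂ R] [CompleteSpace R]

/-- Powers of `a` are eventually dominated by those of any number above the spectral radius. -/
theorem exists_norm_pow_le_of_spectralRadius_lt (a : R) {r : ℝ} (hr : 0 < r)
    (h : spectralRadius ℂ a < ENNReal.ofReal r) : ∃ M : ℝ, ∀ n, ‖a ^ n‖ ≤ M * r ^ n := by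
  have hev : ∀ᶠ n : ℕ in atTop, ‖a ^ n‖ / r ^ n ≤ 1 := by
    filter_upwards [(spectrum.pow_nnnorm_pow_one_div_tendsto_nhds_spectralRadius a).eventually_lt_const
      h, eventually_gt_atTop 0] with n hn hn0
    have hn' : (0 : ℝ) < n := by exact_mod_cast hn0
    rw [div_le_one (by positivity)]
    have := ENNReal.rpow_le_rpow hn.le hn'.le
    rw [← ENNReal.rpow_mul, one_div_mul_cancel hn'.ne', ENNReal.rpow_one, ENNReal.rpow_natCast,
      ← ENNReal.ofReal_pow hr.le, ← enorm_eq_nnnorm, ← ofReal_norm,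
      ENNReal.ofReal_le_ofReal_iff (by positivity)] at this
    exact this
  obtain ⟨M, hM⟩ := (isBoundedUnder_of_eventually_le hev).bddAbove_range
  refine ⟨M, fun n => ?_⟩
  have := hM ⟨n, rfl⟩
  rwa [div_le_iff₀ (by positivity)] at this

/-- By a Neumann series `c^n - a^n` is a unit, and `c - a` is one of its commuting factors. -/
theorem isUnit_smul_one_sub_of_norm_pow_lt (a : R) {c : ℝ} (hc : 0 < c) {n : ℕ}
    (h : ‖a ^ n‖ < c ^ n) : IsUnit ((c : ℂ) • (1 : R) - a) := by
  have hcn : ((c : ℂ) ^ n) ≠ 0 := pow_ne_zero _ (by exact_mod_cast hc.ne')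
  have hcomm : Commute ((c : ℂ) • (1 : R)) a := (Commute.one_left a).smul_left _
  have hu : IsUnit (((c : ℂ) • (1 : R)) ^ n - a ^ n) := by
    have h1 : IsUnit (1 - ((c : ℂ) ^ n)⁻¹ • a ^ n) := by
      apply isUnit_one_sub_of_norm_lt_one
      rw [norm_smul, norm_inv, norm_pow, Complex.norm_real, Real.norm_of_nonneg hc.le,
        inv_mul_lt_one₀ (by positivity)]
      exact h
    have h2 : ((c : ℂ) • (1 : R)) ^ n - a ^ n
        = (Units.mk0 _ hcn) • (1 - ((c : ℂ) ^ n)⁻¹ • a ^ n) := by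
      rw [Units.smul_def, Units.val_mk0, smul_sub, smul_smul, mul_inv_cancel₀ hcn, one_smul,
        smul_pow, one_pow]
    rw [h2]
    exact h1.smul _
  rw [← hcomm.mul_geom_sum₂] at hu
  refine (Commute.isUnit_mul_iff ?_).1 hu |>.1
  refine Commute.sum_right _ _ _ fun i _ => ?_
  have hl : Commute ((c : ℂ) • (1 : R) - a) ((c : ℂ) • (1 : R)) :=
    (Commute.refl _).sub_left hcomm.symm
  have hr : Commute ((c : ℂ) • (1 : R) - a) a := hcomm.sub_left (Commute.refl _)
  exact (hl.pow_right _).mul_right (hr.pow_right _)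

/-- If `a` and `d` commute and `c > ρ(a) + ‖d‖`, then `c - (a + d)` is invertible. -/
theorem isUnit_smul_one_sub_add_of_commute {a d : R} (had : Commute a d) {β q : ℝ} (hβ : 0 ≤ β)
    (hq : ‖d‖ < q) (ha : spectralRadius ℂ a ≤ ENNReal.ofReal β) :
    IsUnit (((β + q : ℝ) : ℂ) • (1 : R) - (a + d)) := by
  have hq0 : 0 < q := (norm_nonneg d).trans_lt hq
  -- Half of the gap pays for Gelfand's formula, the other half keeps `β + ε + ‖d‖ < β + q`; the
  -- binomial theorem bounds `(a + d)^n` by powers of the left side.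
  set ε := (q - ‖d‖) / 2 with hε
  have hε0 : 0 < ε := by rw [hε]; linarith
  obtain ⟨M, hM⟩ := exists_norm_pow_le_of_spectralRadius_lt a (r := β + ε) (by positivity)
    (ha.trans_lt ((ENNReal.ofReal_lt_ofReal_iff (by positivity)).2 (by linarith)))
  have hM0 : 0 ≤ M := by simpa using (norm_nonneg _).trans (hM 0)
  -- The constant covers `n = 0`, since `‖1‖ = 1` is not assumed here.
  have hone : ∃ N : ℝ, 0 ≤ N ∧ ∀ n, ‖d ^ n‖ ≤ N * ‖d‖ ^ n := by
    refine ⟨‖(1 : R)‖ + 1, by positivity, fun n => ?_⟩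
    rcases Nat.eq_zero_or_pos n with rfl | hn
    · simp
    · refine (norm_pow_le' d hn).trans ?_
      exact le_mul_of_one_le_left (by positivity) (by linarith [norm_nonneg (1 : R)])
  obtain ⟨N, hN0, hN⟩ := hone
  have hbound : ∀ n, ‖(a + d) ^ n‖ ≤ M * N * (β + ε + ‖d‖) ^ n := fun n => by
    rw [had.add_pow, add_pow, Finset.mul_sum]
    refine (norm_sum_le _ _).trans (Finset.sum_le_sum fun m _ => ?_)
    rw [← nsmul_eq_mul']
    refine (norm_nsmul_le).trans ?_
    have h1 : ‖a ^ m * d ^ (n - m)‖ ≤ (M * (β + ε) ^ m) * (N * ‖d‖ ^ (n - m)) :=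
      (norm_mul_le _ _).trans (mul_le_mul (hM m) (hN _) (norm_nonneg _) (by positivity))
    calc (n.choose m) * ‖a ^ m * d ^ (n - m)‖
        ≤ (n.choose m) * ((M * (β + ε) ^ m) * (N * ‖d‖ ^ (n - m))) := by gcongr
      _ = _ := by ring
  have hlt : β + ε + ‖d‖ < β + q := by rw [hε]; linarith
  have hrate : Tendsto (fun n : ℕ => M * N * ((β + ε + ‖d‖) / (β + q)) ^ n) atTop (𝓝 0) := by
    simpa using (tendsto_pow_atTop_nhds_zero_of_lt_one (by positivity)
      ((div_lt_one (by positivity)).2 hlt)).const_mul (M * N)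
  obtain ⟨n, hn⟩ := (hrate.eventually_lt_const one_pos).exists
  refine isUnit_smul_one_sub_of_norm_pow_lt (a + d) (by positivity) (n := n)
    ((hbound n).trans_lt ?_)
  rwa [div_pow, ← mul_div_assoc, div_lt_one (by positivity)] at hn

/-- The equation `2 Y = A₁ + Y ^ 2` has a solution of norm less than one that commutes with every
element commuting with `A₁`. -/
theorem exists_norm_lt_one_sq {A₁ X : R} (hA₁ : ‖A₁‖ < 1) (hX : Commute A₁ X) :
    ∃ Y : R, ‖Y‖ < 1 ∧ Commute Y X ∧ (1 - Y) ^ 2 = 1 - A₁ := by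
  set r : ℝ := (1 + ‖A₁‖) / 2 with hr
  have hr0 : 0 ≤ r := by positivity
  -- With `1 - r = (1 - ‖A₁‖) / 2` one has `(1 - r)² ≤ 1 - ‖A₁‖`, so `f` maps the ball of radius `r`
  -- to itself; its Lipschitz constant there is `r`.
  have hr1 : r < 1 := by rw [hr]; linarith
  have hrA : ‖A₁‖ + r * r ≤ 2 * r := by rw [hr]; nlinarith [norm_nonneg A₁]
  let f : R → R := fun Y => (1 / 2 : ℂ) • (A₁ + Y * Y)
  -- Commuting with `X` is a closed condition preserved by `f`, so the fixed point inherits it.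
  let s : Set R := {Y | ‖Y‖ ≤ r ∧ Y * X = X * Y}
  have hs : IsComplete s := by
    apply IsClosed.isComplete
    exact (isClosed_le continuous_norm continuous_const).inter
      (isClosed_eq (by fun_prop) (by fun_prop))
  have hmaps : Set.MapsTo f s s := by
    rintro Y ⟨hY, hYX⟩
    have hYX' : Commute Y X := hYX
    refine ⟨?_, ((hX.add_left (hYX'.mul_left hYX')).smul_left _).eq⟩
    change ‖(1 / 2 : ℂ) • (A₁ + Y * Y)‖ ≤ r
    rw [norm_smul]
    have h1 : ‖A₁ + Y * Y‖ ≤ ‖A₁‖ + r * r :=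
      (norm_add_le _ _).trans (add_le_add le_rfl ((norm_mul_le _ _).trans
        (mul_le_mul hY hY (norm_nonneg _) hr0)))
    norm_num
    linarith
  have hcontr : ContractingWith ⟨r, hr0⟩ (hmaps.restrict f s s) := by
    refine ⟨by exact_mod_cast hr1, LipschitzWith.of_dist_le_mul ?_⟩
    rintro ⟨Y, hY, hYX⟩ ⟨W, hW, hWX⟩
    rw [Subtype.dist_eq, Subtype.dist_eq]
    change dist ((1 / 2 : ℂ) • (A₁ + Y * Y)) ((1 / 2 : ℂ) • (A₁ + W * W)) ≤ r * dist Y W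
    rw [dist_eq_norm, dist_eq_norm, ← smul_sub, norm_smul]
    have h1 : A₁ + Y * Y - (A₁ + W * W) = Y * (Y - W) + (Y - W) * W := by noncomm_ring
    have h2 : ‖A₁ + Y * Y - (A₁ + W * W)‖ ≤ r * ‖Y - W‖ + ‖Y - W‖ * r := by
      rw [h1]
      refine (norm_add_le _ _).trans (add_le_add ?_ ?_)
      · exact (norm_mul_le _ _).trans (by gcongr)
      · exact (norm_mul_le _ _).trans (by gcongr)
    rw [show ‖(1 / 2 : ℂ)‖ = 1 / 2 by norm_num]
    linarith
  obtain ⟨Y, ⟨hY, hYX⟩, hfix, -⟩ := hcontr.exists_fixedPoint' hs hmaps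
    (x := 0) ⟨by simpa using hr0, by simp⟩ (edist_ne_top _ _)
  refine ⟨Y, hY.trans_lt hr1, hYX, ?_⟩
  have h2 : A₁ + Y * Y = 2 * Y := by
    have h3 : (1 / 2 : ℂ) • (A₁ + Y * Y) = Y := hfix
    have h4 : (2 : ℂ) • ((1 / 2 : ℂ) • (A₁ + Y * Y)) = (2 : ℂ) • Y := by rw [h3]
    rw [smul_smul] at h4
    norm_num at h4
    rw [h4, two_smul, two_mul]
  have h5 : A₁ = 2 * Y - Y * Y := by rw [← h2]; noncomm_ring
  rw [h5]; noncomm_ring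

/-- If `‖A₁‖ < 1` and `1 - B` is an M-type square root of `1 - A₁`, then `‖B‖ < 1`. -/
theorem norm_lt_one_of_sq {A₁ B C : R} {β : ℝ} (hA₁ : ‖A₁‖ < 1) (hβ : 0 ≤ β)
    (hC : spectralRadius ℂ C ≤ ENNReal.ofReal β) (hB : 1 - B = (β : ℂ) • (1 : R) - C)
    (hsq : (1 - B) ^ 2 = 1 - A₁) : ‖B‖ < 1 := by
  have hcomm : Commute A₁ B := by
    have h : A₁ = 2 * B - B * B := by
      have : A₁ = 1 - (1 - B) ^ 2 := by rw [hsq]; noncomm_ring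
      rw [this]; noncomm_ring
    rw [h]
    exact ((Commute.ofNat_left 2 B).mul_left (Commute.refl B)).sub_left
      ((Commute.refl B).mul_left (Commute.refl B))
  obtain ⟨Y, hY, hYB, hYsq⟩ := exists_norm_lt_one_sq hA₁ hcomm
  have hCeq : C = (β : ℂ) • (1 : R) - (1 - B) := by rw [hB]; abel
  have hCY : Commute C Y := by
    rw [hCeq]
    exact ((Commute.one_left Y).smul_left _).sub_left ((Commute.one_left Y).sub_left hYB.symm)
  have hu := isUnit_smul_one_sub_add_of_commute hCY hβ hY hC
  have hu' : ((β + 1 : ℝ) : ℂ) • (1 : R) - (C + Y) = (1 - B) + (1 - Y) := by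
    rw [hB]; push_cast; rw [add_smul, one_smul]; abel
  rw [hu'] at hu
  -- Difference of two equal squares, factored because `Y` and `B` commute.
  have hprod : ((1 - B) + (1 - Y)) * (Y - B) = 0 := by
    have h : ((1 - B) + (1 - Y)) * (Y - B) = (1 - B) ^ 2 - (1 - Y) ^ 2 + (Y * B - B * Y) := by
      noncomm_ring
    rw [h, hsq, hYsq, hYB.eq]; simp
  rw [hu.mul_right_eq_zero, sub_eq_zero] at hprod
  rwa [← hprod]

theorem isUnit_two_sub_of_norm_lt_one {a : R} (ha : ‖a‖ < 1) : IsUnit (2 - a) := by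
  have h := isUnit_smul_one_sub_of_norm_pow_lt a (c := 2) two_pos (n := 1) (by simpa using by linarith)
  have h2 : (((2 : ℝ) : ℂ) • (1 : R)) = 2 := by
    push_cast; rw [two_smul, one_add_one_eq_two]
  rwa [h2] at h

/-- From `2v = 1 + v a` follows `(2 - ‖a‖) ‖v‖ ≤ 1`. -/
theorem norm_inverse_two_sub_lt_one [NormOneClass R] {a : R} (ha : ‖a‖ < 1) :
    ‖Ring.inverse (2 - a)‖ < 1 := by
  have h := Ring.inverse_mul_cancel _ (isUnit_two_sub_of_norm_lt_one ha)
  set v := Ring.inverse (2 - a)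
  have hv : (2 : ℂ) • v = 1 + v * a := by rw [← h, two_smul]; noncomm_ring
  have h1 : 2 * ‖v‖ ≤ 1 + ‖v‖ * ‖a‖ := by
    calc 2 * ‖v‖ = ‖(2 : ℂ) • v‖ := by rw [norm_smul]; norm_num
      _ ≤ ‖(1 : R)‖ + ‖v * a‖ := by rw [hv]; exact norm_add_le _ _
      _ ≤ _ := by rw [norm_one]; gcongr; exact norm_mul_le _ _
  by_contra! h2
  nlinarith [norm_nonneg v]

/-! ### Convergence of the doubling algorithm -/

theorem tendsto_enorm_pow_two_pow (a : R) :
    Tendsto (fun k : ℕ => ‖a ^ 2 ^ k‖ₑ ^ ((1 : ℝ) / 2 ^ k)) atTop (𝓝 (spectralRadius ℂ a)) := by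
  have h := (spectrum.pow_nnnorm_pow_one_div_tendsto_nhds_spectralRadius a).comp
    (tendsto_pow_atTop_atTop_of_one_lt one_lt_two)
  refine h.congr fun k => ?_
  simp [enorm_eq_nnnorm]

theorem tendsto_const_rpow_one_div_two_pow {c : ℝ≥0∞} (hc : c ≠ 0) (hc' : c ≠ ∞) :
    Tendsto (fun k : ℕ => c ^ ((1 : ℝ) / 2 ^ k)) atTop (𝓝 1) := by
  lift c to NNReal using hc'
  have hc0 : c ≠ 0 := by exact_mod_cast hc
  have h : Tendsto (fun k : ℕ => (1 : ℝ) / 2 ^ k) atTop (𝓝 0) := by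
    simpa using tendsto_pow_atTop_nhds_zero_of_lt_one (r := (1 / 2 : ℝ)) (by norm_num) (by norm_num)
  have h2 := (ENNReal.tendsto_coe.2 ((tendsto_const_nhds (x := c)).nnrpow h (Or.inl hc0)))
  simp only [NNReal.rpow_zero, ENNReal.coe_one] at h2
  refine h2.congr fun k => ?_
  rw [ENNReal.coe_rpow_of_ne_zero hc0]

theorem sda_quadratic_convergence {s : SSF R} {X W Y Z : R} (h : s.Solves X W)
    (h' : s.swap.Solves Y Z) (hs : s.NoBreakdown)
    (hWZ : Tendsto (fun k : ℕ => ‖Z ^ 2 ^ k‖ * ‖W ^ 2 ^ k‖) atTop (𝓝 0))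
    (hW : spectralRadius ℂ W ≠ ∞) (hZ : spectralRadius ℂ Z ≠ ∞) :
    Tendsto (fun k => (s.sda k).P) atTop (𝓝 X) ∧
    limsup (fun k : ℕ => ‖X - (s.sda k).P‖ₑ ^ ((1 : ℝ) / 2 ^ k)) atTop
      ≤ spectralRadius ℂ W * spectralRadius ℂ Z := by
  have hprod : ∀ (u : R) (k : ℕ), ‖u * Z ^ 2 ^ k * X * W ^ 2 ^ k‖
      ≤ ‖u‖ * ‖X‖ * (‖Z ^ 2 ^ k‖ * ‖W ^ 2 ^ k‖) := fun u k => by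
    calc ‖u * Z ^ 2 ^ k * X * W ^ 2 ^ k‖ ≤ ‖u‖ * ‖Z ^ 2 ^ k‖ * ‖X‖ * ‖W ^ 2 ^ k‖ := by
          refine (norm_mul_le _ _).trans ?_
          gcongr
          refine (norm_mul_le _ _).trans ?_
          gcongr
          exact norm_mul_le _ _
      _ = _ := by ring
  -- The factor 2 comes from absorbing `‖D‖ / 2`; the added 1 keeps `c` positive, so that
  -- `c^(1/2^k)` tends to 1.
  set c : ℝ := 2 * (‖1 - X * Y‖ * ‖X‖) + 1 with hc
  have hc0 : 0 < c := by positivity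
  have hsmall : ∀ᶠ k : ℕ in atTop, ‖Y * Z ^ 2 ^ k * X * W ^ 2 ^ k‖ ≤ 1 / 2 := by
    have h0 : Tendsto (fun k : ℕ => ‖Y‖ * ‖X‖ * (‖Z ^ 2 ^ k‖ * ‖W ^ 2 ^ k‖)) atTop (𝓝 0) := by
      simpa using hWZ.const_mul (‖Y‖ * ‖X‖)
    filter_upwards [h0.eventually_le_const (show (0 : ℝ) < 1 / 2 by norm_num)] with k hk
    exact (hprod Y k).trans hk
  have hbound : ∀ᶠ k : ℕ in atTop,
      ‖X - (s.sda k).P‖ ≤ c * (‖Z ^ 2 ^ k‖ * ‖W ^ 2 ^ k‖) := by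
    filter_upwards [hsmall] with k hk
    have herr := SSF.error_eq h h' hs k
    set D := X - (s.sda k).P
    have h1 : ‖D‖ ≤ ‖1 - X * Y‖ * ‖X‖ * (‖Z ^ 2 ^ k‖ * ‖W ^ 2 ^ k‖) + ‖D‖ * (1 / 2) := by
      calc ‖D‖ = ‖(1 - X * Y) * Z ^ 2 ^ k * X * W ^ 2 ^ k
              + D * (Y * Z ^ 2 ^ k * X * W ^ 2 ^ k)‖ := by rw [← herr]
        _ ≤ _ := (norm_add_le _ _).trans (add_le_add (hprod _ k)
              ((norm_mul_le _ _).trans (by gcongr)))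
    have h2 : 0 ≤ ‖Z ^ 2 ^ k‖ * ‖W ^ 2 ^ k‖ := by positivity
    rw [hc]
    linarith
  constructor
  · rw [tendsto_iff_norm_sub_tendsto_zero]
    refine squeeze_zero' (Eventually.of_forall fun _ => norm_nonneg _) ?_
      (by simpa using hWZ.const_mul c)
    filter_upwards [hbound] with k hk
    rwa [norm_sub_rev]
  · have hlim : Tendsto (fun k : ℕ => ENNReal.ofReal c ^ ((1 : ℝ) / 2 ^ k)
        * (‖W ^ 2 ^ k‖ₑ ^ ((1 : ℝ) / 2 ^ k) * ‖Z ^ 2 ^ k‖ₑ ^ ((1 : ℝ) / 2 ^ k))) atTop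
        (𝓝 (1 * (spectralRadius ℂ W * spectralRadius ℂ Z))) := by
      refine ENNReal.Tendsto.mul (tendsto_const_rpow_one_div_two_pow (by simpa using hc0) (by simp))
        (Or.inl one_ne_zero) ?_ (Or.inr ENNReal.one_ne_top)
      exact ENNReal.Tendsto.mul (tendsto_enorm_pow_two_pow W) (Or.inr hZ)
        (tendsto_enorm_pow_two_pow Z) (Or.inr hW)
    rw [one_mul] at hlim
    rw [← hlim.limsup_eq]
    refine limsup_le_limsup ?_
    filter_upwards [hbound] with k hk
    have he : (0 : ℝ) ≤ 1 / 2 ^ k := by positivity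
    rw [← ENNReal.mul_rpow_of_nonneg _ _ he, ← ENNReal.mul_rpow_of_nonneg _ _ he]
    refine ENNReal.rpow_le_rpow ?_ he
    rw [← ofReal_norm, ← ofReal_norm, ← ofReal_norm, ← ENNReal.ofReal_mul (by positivity),
      ← ENNReal.ofReal_mul hc0.le]
    exact ENNReal.ofReal_le_ofReal (by rwa [mul_comm ‖W ^ 2 ^ k‖])

/-- The doubling algorithm for the correction `X = B - T` of a square root `1 - B` of `1 - A₁`
with `‖B‖ < 1` and `‖T‖ < 1`. -/
theorem sda_convergence_of_sq [NormOneClass R] {A₁ B T X : R} (hB1 : ‖B‖ < 1) (hT1 : ‖T‖ < 1)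
    (hB : B = T + X) (hsq : (1 - B) ^ 2 = 1 - A₁) :
    let S := Ring.inverse (2 - T)
    let V := Ring.inverse (2 - B)
    let Z := (1 - T * V) * V * Ring.inverse (1 - T * V)
    let s := SSF.mk (S * A₁) (S * (T ^ 2 - 2 * T + A₁)) S S
    IsUnit (2 - T) ∧ IsUnit (2 - B) ∧ IsUnit (1 - T * V) ∧
    (s.NoBreakdown →
      Tendsto (fun k => (s.sda k).P) atTop (𝓝 X) ∧
      limsup (fun k : ℕ => ‖X - (s.sda k).P‖ₑ ^ ((1 : ℝ) / 2 ^ k)) atTop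
        ≤ spectralRadius ℂ B * spectralRadius ℂ Z ∧
      spectralRadius ℂ B * spectralRadius ℂ Z < 1) := by
  intro S V Z s
  have huT : IsUnit (2 - T) := isUnit_two_sub_of_norm_lt_one hT1
  have huB : IsUnit (2 - B) := isUnit_two_sub_of_norm_lt_one hB1
  have hV1 : ‖V‖ < 1 := norm_inverse_two_sub_lt_one hB1
  have huTV : IsUnit (1 - T * V) := isUnit_one_sub_of_norm_lt_one
    ((norm_mul_le _ _).trans_lt (mul_lt_one_of_nonneg_of_lt_one_left (norm_nonneg _) hT1 hV1.le))
  refine ⟨huT, huB, huTV, fun hs => ?_⟩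
  have hS1 : S * (2 - T) = 1 := Ring.inverse_mul_cancel _ huT
  have hVr : (2 - B) * V = 1 := Ring.mul_inverse_cancel _ huB
  have hsol : s.Solves X B := solves_of_sq hB hsq hS1
  have hsol' : s.swap.Solves (V * Ring.inverse (1 - T * V)) Z :=
    swap_solves_of_sq hsq hS1 hVr (Ring.mul_inverse_cancel _ huTV)
      (Ring.inverse_mul_cancel _ huTV)
  obtain ⟨u, hu⟩ := huTV
  have hZu : Z = u * V * (u⁻¹ : Rˣ) := by simp only [Z, ← hu, Ring.inverse_unit]
  have hρB : spectralRadius ℂ B < 1 := (spectrum.spectralRadius_le_nnnorm B).trans_lt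
    (by exact_mod_cast hB1)
  -- `Z` itself may have large norm; only its similarity to `V` is used.
  have hρZ : spectralRadius ℂ Z < 1 := by
    rw [hZu, spectralRadius, spectrum.units_conjugate]
    exact (spectrum.spectralRadius_le_nnnorm V).trans_lt (by exact_mod_cast hV1)
  have hlim : Tendsto (fun k : ℕ => ‖Z ^ 2 ^ k‖ * ‖B ^ 2 ^ k‖) atTop (𝓝 0) := by
    have htwo := tendsto_pow_atTop_atTop_of_one_lt (r := 2) one_lt_two
    have hBlim := ((tendsto_pow_atTop_nhds_zero_of_norm_lt_one hB1).comp htwo).norm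
    have hVlim := (tendsto_pow_atTop_nhds_zero_of_norm_lt_one hV1).comp htwo
    have hZlim := ((hVlim.const_mul (u : R)).mul_const ((u⁻¹ : Rˣ) : R)).norm
    have h := hZlim.mul hBlim
    simp only [mul_zero, zero_mul, norm_zero] at h
    refine h.congr fun k => ?_
    simp only [Function.comp_apply]
    rw [hZu, Units.conj_pow]
  obtain ⟨h₁, h₂⟩ := sda_quadratic_convergence hsol hsol' hs hlim (hρB.trans ENNReal.one_lt_top).ne
    (hρZ.trans ENNReal.one_lt_top).ne
  exact ⟨h₁, h₂, mul_lt_one' hρB hρZ⟩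

end BanachAlgebra

/-! ### Toeplitz operators -/

theorem matrixOp_apply (m : ℕ → ℕ → ℂ) (hm : BoundedRows m) (x : LInf) (i : ℕ) :
    matrixOp m hm x i = ∑' j, m i j * x j := rfl

theorem norm_toeplitz_le (b : Wiener) : ‖toeplitz b‖ ≤ ∑' n, ‖b.1 n‖ := by
  have hC : 0 ≤ ∑' n, ‖b.1 n‖ := tsum_nonneg fun _ => norm_nonneg _
  refine ContinuousLinearMap.opNorm_le_bound _ hC fun x => ?_
  refine lp.norm_le_of_forall_le (mul_nonneg hC (norm_nonneg x)) fun i => ?_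
  refine (BoundedRows.row_bound (m := fun i j => b.1 ((j : ℤ) - (i : ℤ))) (C := ∑' n, ‖b.1 n‖)
    (fun i => ?_) x i).2
  have hinj : Function.Injective (fun j : ℕ => (j : ℤ) - (i : ℤ)) := fun j k h => by
    simpa using h
  exact ⟨b.2.comp_injective hinj, tsum_comp_le_tsum_of_inj b.2 (fun _ => norm_nonneg _) hinj⟩

/-- The row sums of `T(b)` are bounded by `‖T(b) + E‖` up to the row sums of `E`. -/
theorem tsum_norm_row_le (b : Wiener) {e : ℕ → ℕ → ℂ} (he : BoundedRows e) (i : ℕ) :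
    ∑' j : ℕ, ‖b.1 ((j : ℤ) - i)‖ ≤ ‖toeplitz b + matrixOp e he‖ + ∑' j, ‖e i j‖ := by
  -- Conjugate phases (with `p 0 = 0`) form a test vector turning entry `i` of `T(b) x` into the
  -- absolute row sum.
  let p : ℂ → ℂ := fun z => (starRingEnd ℂ z) / (‖z‖ : ℂ)
  have hp : ∀ z, ‖p z‖ ≤ 1 := fun z => by
    simp only [p, norm_div, RCLike.norm_conj, Complex.norm_real, norm_norm]
    exact div_self_le_one _
  have hmul : ∀ z, z * p z = (‖z‖ : ℂ) := fun z => by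
    rcases eq_or_ne z 0 with rfl | hz
    · simp
    · have hz' : (‖z‖ : ℂ) ≠ 0 := by exact_mod_cast norm_ne_zero_iff.2 hz
      simp only [p]
      rw [← mul_div_assoc, Complex.mul_conj', pow_two, mul_div_assoc, div_self hz', mul_one]
  let x : LInf := ⟨fun j => p (b.1 ((j : ℤ) - i)), memℓp_infty ⟨1, by
    rintro _ ⟨j, rfl⟩
    exact hp _⟩⟩
  have hx : ‖x‖ ≤ 1 := lp.norm_le_of_forall_le zero_le_one fun j => hp _
  have hT : toeplitz b x i = ((∑' j : ℕ, ‖b.1 ((j : ℤ) - i)‖ : ℝ) : ℂ) := by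
    rw [toeplitz, matrixOp_apply, Complex.ofReal_tsum]
    exact tsum_congr fun j => hmul _
  have hE : ‖matrixOp e he x i‖ ≤ ∑' j, ‖e i j‖ := by
    obtain ⟨C, hC⟩ := id he
    rw [matrixOp_apply]
    have hle : ∀ j, ‖e i j * x j‖ ≤ ‖e i j‖ := fun j => by
      rw [norm_mul]
      exact mul_le_of_le_one_right (norm_nonneg _) (hp _)
    have hs := (BoundedRows.row_bound hC x i).1
    exact (norm_tsum_le_tsum_norm hs).trans (hs.tsum_le_tsum hle (hC i).1)
  have hsum : ‖toeplitz b x i + matrixOp e he x i‖ ≤ ‖toeplitz b + matrixOp e he‖ := by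
    calc ‖toeplitz b x i + matrixOp e he x i‖ = ‖(toeplitz b + matrixOp e he) x i‖ := rfl
      _ ≤ ‖(toeplitz b + matrixOp e he) x‖ := lp.norm_apply_le_norm ENNReal.top_ne_zero _ i
      _ ≤ ‖toeplitz b + matrixOp e he‖ * ‖x‖ := ContinuousLinearMap.le_opNorm _ _
      _ ≤ _ := mul_le_of_le_one_right (norm_nonneg _) hx
  have hnn : 0 ≤ ∑' j : ℕ, ‖b.1 ((j : ℤ) - i)‖ := tsum_nonneg fun _ => norm_nonneg _
  calc ∑' j : ℕ, ‖b.1 ((j : ℤ) - i)‖ = ‖toeplitz b x i‖ := by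
        rw [hT, Complex.norm_real, Real.norm_of_nonneg hnn]
    _ = ‖(toeplitz b x i + matrixOp e he x i) - matrixOp e he x i‖ := by rw [add_sub_cancel_right]
    _ ≤ _ := (norm_sub_le _ _).trans (add_le_add hsum hE)

/-- Removing a `𝓚_d` correction does not increase the norm. -/
theorem norm_toeplitz_le_norm_add (b : Wiener) {E : LInfOp} (hE : E ∈ Kd) :
    ‖toeplitz b‖ ≤ ‖toeplitz b + E‖ := by
  obtain ⟨e, he, hlim, rfl⟩ := hE
  refine (norm_toeplitz_le b).trans (b.2.tsum_le_of_sum_le fun s => ?_)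
  have hlim' : Tendsto (fun i => ‖toeplitz b + matrixOp e he‖ + ∑' j, ‖e i j‖) atTop
      (𝓝 (‖toeplitz b + matrixOp e he‖)) := by
    simpa using hlim.const_add (‖toeplitz b + matrixOp e he‖)
  refine ge_of_tendsto hlim' ?_
  -- Row `i` of `T(b)` contains exactly the coefficients of index at least `-i`, so every row from
  -- `N` on sees all of `s`.
  obtain ⟨N, hN⟩ : ∃ N : ℕ, ∀ n ∈ s, -(N : ℤ) ≤ n :=
    ⟨s.sup Int.natAbs, fun n hn => by
      have := Finset.le_sup (f := Int.natAbs) hn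
      omega⟩
  filter_upwards [eventually_ge_atTop N] with i hi
  refine le_trans ?_ (tsum_norm_row_le b he i)
  have hinj : Function.Injective (fun j : ℕ => (j : ℤ) - (i : ℤ)) := fun j k h => by
    simpa using h
  have hsub : ∑ n ∈ s, ‖b.1 n‖
      = ∑ j ∈ s.preimage (fun j : ℕ => (j : ℤ) - (i : ℤ)) hinj.injOn, ‖b.1 ((j : ℤ) - i)‖ := by
    refine (Finset.sum_preimage _ s hinj.injOn (fun n => ‖b.1 n‖) fun n hn hn' => ?_).symm
    refine absurd ⟨(n + i).toNat, ?_⟩ hn'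
    have := hN n hn
    change (((n + i).toNat : ℕ) : ℤ) - i = n
    omega
  rw [hsub]
  have hsummable : Summable fun j : ℕ => ‖b.1 ((j : ℤ) - i)‖ := b.2.comp_injective hinj
  exact hsummable.sum_le_tsum _ fun _ _ => norm_nonneg _

/-! ### The theorem for quasi-Toeplitz matrices -/

instance : Nontrivial LInf := ⟨0, 1, fun h => by
  have := congrArg norm h
  rw [norm_zero, norm_one] at this
  exact zero_ne_one this⟩

instance : NormOneClass LInfOp := ⟨ContinuousLinearMap.norm_id⟩

theorem mainTheorem3 (A A₁ B E_B : LInfOp) (b : Wiener)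
    (hA : A ∈ QT) (hAA₁ : A = 1 - A₁) (hA₁ : EntrywiseNonneg A₁) (hA₁_norm : ‖A₁‖ < 1)
    (hE_B : E_B ∈ Kd) (hB : B = toeplitz b + E_B)
    (hM : IsQTMMatrix (1 - B)) (hsq : (1 - B) ^ 2 = A)
    (S R V Z : LInfOp)
    (hS : S = Ring.inverse (2 - toeplitz b))
    (hR : R = toeplitz b ^ 2 - 2 * toeplitz b + A₁)
    (hV : V = Ring.inverse (2 - B))
    (hZ : Z = (1 - toeplitz b * V) * V * Ring.inverse (1 - toeplitz b * V))
    (pencil : SSF LInfOp)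
    (hpM : pencil.M = !![S * A₁, 0; -(S * R), 1])
    (hpN : pencil.N = !![1, -S; 0, S]) :
    IsUnit (2 - toeplitz b) ∧ IsUnit (2 - B) ∧ IsUnit (1 - toeplitz b * V) ∧
    (pencil.NoBreakdown →
      Tendsto (fun k => (pencil.sda k).P) atTop (𝓝 E_B) ∧
      limsup (fun k : ℕ => ‖E_B - (pencil.sda k).P‖ₑ ^ ((1 : ℝ) / 2 ^ k)) atTop
        ≤ spectralRadius ℂ B * spectralRadius ℂ Z ∧
      spectralRadius ℂ B * spectralRadius ℂ Z < 1) := by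
  obtain ⟨-, β, C, hβ, -, hρ, hBC⟩ := hM
  rw [hAA₁] at hsq
  have hB1 : ‖B‖ < 1 := norm_lt_one_of_sq hA₁_norm hβ hρ hBC hsq
  have hT1 : ‖toeplitz b‖ < 1 :=
    (norm_toeplitz_le_norm_add b hE_B).trans_lt (by rwa [← hB])
  subst hS hR hV hZ
  have hpencil : pencil = SSF.mk (Ring.inverse (2 - toeplitz b) * A₁)
      (Ring.inverse (2 - toeplitz b) * (toeplitz b ^ 2 - 2 * toeplitz b + A₁))
      (Ring.inverse (2 - toeplitz b)) (Ring.inverse (2 - toeplitz b)) := by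
    ext1
    · exact congrFun (congrFun hpM 0) 0
    · exact neg_injective (congrFun (congrFun hpM 1) 0)
    · exact congrFun (congrFun hpN 1) 1
    · exact neg_injective (congrFun (congrFun hpN 0) 1)
  rw [hpencil]
  exact sda_convergence_of_sq hB1 hT1 hB hsq
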